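/- Let $\mathcal V$ and $\mathcal H$ be real Hilbert spaces and $\iota:\mathcal V\to\mathcal H$ a continuous linear map. (For a Hilbert triplet $\mathcal V\subset\mathcal H\subset\mathcal V^*$, $\iota$ is the continuous dense embedding; this covers $\mathcal H=L^2(\Omega)\times L^2(\Gamma)$ and $\mathcal V=\{(v,v_\Gamma)\in H^1(\Omega)\times H^1(\Gamma): v_\Gamma=v_{|\Gamma}\}$, where $\Gamma=\partial\Omega$. Injectivity and density of $\iota$ are not required.) Write $\langle\cdot,\cdot\rangle_{\mathcal V}$ for the duality pairing between $\mathcal V^*$ and $\mathcal V$. An element $v\in\mathcal V$ is regarded as the element $\iota v$ of $\mathcal H$, and an element $h\in\mathcal H$ as the functional $v\mapsto(h,\iota v)_{\mathcal H}$ in $\mathcal V^*$. For $T>0$ and a Banach space $X$, $H^1(0,T;X)$ is the space of all $u\in L^2(0,T;X)$ that have a weak derivative $u'\in L^2(0,T;X)$. Assume that $$y\in H^1(0,T;\mathcal H)\cap L^2(0,T;\mathcal V)\quad\text{and}\quad z\in H^1(0,T;\mathcal V^*)\cap L^2(0,T;\mathcal H).$$ Then the function $t\mapsto(y(t),z(t))_{\mathcal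 H}$ is absolutely continuous on $[0,T]$ and $$\frac{d}{dt}(y,z)_{\mathcal H}=(y',z)_{\mathcal H}+\langle z',y\rangle_{\mathcal V}\quad\text{a.e. in }(0,T).$$ Precisely: there is an absolutely continuous function $g:[0,T]\to\mathbb R$ such that $g(t)=(y(t),z(t))_{\mathcal H}$ for a.e. $t\in(0,T)$ and $g'(t)=(y'(t),z(t))_{\mathcal H}+\langle z'(t),y(t)\rangle_{\mathcal V}$ for a.e. $t\in(0,T)$. Moreover, $y$ and $z$ have continuous representatives $\hat y\in C^0([0,T];\mathcal H)$ and $\hat z\in C^0([0,T];\mathcal V^*)$, and for every $t\in[0,T]$: if $\hat z(t)$ is the functional given by some $h\in\mathcal H$, then $g(t)=(\hat y(t),h)_{\mathcal H}$; if $\hat y(t)=\iota v$ for some $v\in\mathcal V$, then $g(t)=\langle\hat z(t),v\rangle_{\mathcal V}$. -/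

import Mathlib

open MeasureTheory Set
open scoped ContDiff

noncomputable section

/-- `u ∈ L²(0,T;X)`: strongly measurable (almost everywhere on `(0,T)`) and square integrable. -/
def MemL2 {X : Type*} [NormedAddCommGroup X] (T : ℝ) (u : ℝ → X) : Prop :=
  MemLp u 2 (volume.restrict (Ioo 0 T))

/-- `u'` is the weak (distributional) derivative of `u` on `(0,T)`: both are locally integrable, and
`∫ φ' u = - ∫ φ u'` for every `φ ∈ C_c^∞(0,T)`. -/
structure IsWeakDeriv {X : Type*} [NormedAddCommGroup X] [NormedSpace ℝ X]
    (T : ℝ) (u u' : ℝ → X) : Prop where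
  locallyIntegrable : LocallyIntegrableOn u (Ioo 0 T)
  locallyIntegrable_deriv : LocallyIntegrableOn u' (Ioo 0 T)
  integral_eq : ∀ φ : ℝ → ℝ, ContDiff ℝ ∞ φ → HasCompactSupport φ → tsupport φ ⊆ Ioo 0 T →
    ∫ t in Ioo 0 T, deriv φ t • u t = -∫ t in Ioo 0 T, φ t • u' t

/-- `u ∈ H¹(0,T;X)`: `u ∈ L²(0,T;X)` with a weak derivative in `L²(0,T;X)`. -/
def MemH1 {X : Type*} [NormedAddCommGroup X] [NormedSpace ℝ X] (T : ℝ) (u : ℝ → X) : Prop :=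
  MemL2 T u ∧ ∃ u' : ℝ → X, MemL2 T u' ∧ IsWeakDeriv T u u'

/-- The map `H → V*` that a continuous linear map `ι : V → H` induces (for a Hilbert triplet, the
embedding `H ⊂ V*`): it sends `h` to the functional `v ↦ (h, ι v)_H`. -/
def toDualOf {V H : Type*} [NormedAddCommGroup V] [NormedSpace ℝ V]
    [NormedAddCommGroup H] [InnerProductSpace ℝ H] (ι : V →L[ℝ] H) (h : H) : StrongDual ℝ V :=
  (innerSL ℝ h).comp ι

/-- `w` is the continuous representative on `[0,T]` of the function `u` on `(0,T)`. -/
def IsContRepr {X : Type*} [NormedAddCommGroup X] (T : ℝ) (u w : ℝ → X) : Prop :=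
  ContinuousOn w (Icc 0 T) ∧ ∀ᵐ t ∂(volume.restrict (Ioo 0 T)), w t = u t

end

open MeasureTheory Set Filter Topology
open scoped ContDiff ENNReal

/-! For h > 0 and almost every t, the increment of f = (y,z)_H from t to t+h splits exactly as
(y(t+h) - y(t), z(t+h))_H + ⟨z(t+h) - z(t), y(t)⟩_V. Divided by h, the increments of y and z are
Steklov averages of y' and z', which converge in L² to y' and z'. Integration over [a,b] and h → 0
give f(b) - f(a) on the left, at points where the primitive of f has derivative f, and the integral
of the expected derivative on the right (`exists_ae_sub_eq_integral_of_difference`). Hence f agrees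
a.e. with a primitive g of an integrable function.

The values at a fixed t rest on Hölder-1/2 continuity. If the representative of z at t is given by h
in H, then g(s) - (y(s),h)_H = ⟨z(s) - z(t), y(s)⟩_V for a.e. s, with square at most C|s - t|
‖y(s)‖². A nonzero limit at s = t would make 1/|s - t| integrable near t
(`eq_of_sq_sub_le_abs_sub_mul`). The other case is symmetric. -/

/-! ### Translations and Steklov averages in L²(ℝ) -/

/-- The translation action of ℝ on Lᵖ is continuous for finite p; this is its continuity at r = 0.
-/
theorem tendsto_eLpNorm_comp_const_add_sub {E : Type*} [NormedAddCommGroup E] {p : ℝ≥0∞}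
    (hp1 : 1 ≤ p) (hp : p ≠ ⊤) {U : ℝ → E} (hU : MemLp U p) :
    Tendsto (fun r : ℝ => eLpNorm (fun t => U (r + t) - U t) p) (𝓝 0) (𝓝 0) := by
  have : Fact (1 ≤ p) := ⟨hp1⟩
  have : Fact (p ≠ ⊤) := ⟨hp⟩
  have hc : Tendsto (fun r : ℝ => edist (DomAddAct.mk r +ᵥ hU.toLp U) (hU.toLp U)) (𝓝 0) (𝓝 0) := by
    have h1 : Continuous (fun r : ℝ => edist (DomAddAct.mk r +ᵥ hU.toLp U) (hU.toLp U)) := by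
      have h2 : Continuous (fun r : ℝ => DomAddAct.mk r) := by
        exact DomAddAct.continuous_mk
      exact (h2.vadd continuous_const).edist continuous_const
    have := h1.tendsto 0
    simpa using this
  refine hc.congr fun r => ?_
  rw [DomAddAct.mk_vadd_toLp, Lp.edist_toLp_toLp]
  rfl

theorem MeasureTheory.MemLp.intervalIntegrable {E : Type*} [NormedAddCommGroup E] {U : ℝ → E}
    (hU : MemLp U 2) (a b : ℝ) : IntervalIntegrable U volume a b :=
  (hU.locallyIntegrable (by norm_num)).integrableOn_isCompact isCompact_uIcc |>.intervalIntegrable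

theorem eLpNorm_two_sq {α E : Type*} [MeasurableSpace α] [NormedAddCommGroup E]
    {μ : Measure α} (D : α → E) : eLpNorm D 2 μ ^ 2 = ∫⁻ r, ‖D r‖ₑ ^ 2 ∂μ := by
  have := eLpNorm_nnreal_pow_eq_lintegral (f := D) (μ := μ) (p := 2) (by norm_num)
  simpa using this

theorem enorm_integral_sq_le_lintegral {α E : Type*} [MeasurableSpace α] [NormedAddCommGroup E]
    [NormedSpace ℝ E] {ν : Measure α} [IsProbabilityMeasure ν] {D : α → E}
    (hD : AEStronglyMeasurable D ν) : ‖∫ r, D r ∂ν‖ₑ ^ 2 ≤ ∫⁻ r, ‖D r‖ₑ ^ 2 ∂ν := by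
  have h1 : ‖∫ r, D r ∂ν‖ₑ ≤ eLpNorm D 2 ν := by
    refine (enorm_integral_le_lintegral_enorm _).trans ?_
    rw [← eLpNorm_one_eq_lintegral_enorm]
    exact eLpNorm_le_eLpNorm_of_exponent_le (by norm_num) hD
  exact (eLpNorm_two_sq D (μ := ν)) ▸ pow_le_pow_left' h1 2

/-- The forward Steklov averages of a function in `L²(ℝ)` converge to it in `L²(ℝ)`. -/
theorem tendsto_eLpNorm_steklov_sub {E : Type*} [NormedAddCommGroup E] [NormedSpace ℝ E]
    [CompleteSpace E] {U : ℝ → E} (hUm : StronglyMeasurable U) (hU : MemLp U 2) :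
    Tendsto (fun h : ℝ => eLpNorm (fun t => h⁻¹ • (∫ r in t..t + h, U r) - U t) 2)
      (𝓝[>] 0) (𝓝 0) := by
  rw [ENNReal.tendsto_nhds_zero]
  intro ε hε
  have h0 := (ENNReal.tendsto_nhds_zero.1
    (tendsto_eLpNorm_comp_const_add_sub (by norm_num) (by norm_num) hU)) ε hε
  obtain ⟨δ, hδ, hδ'⟩ := Metric.eventually_nhds_iff.1 h0
  filter_upwards [Ioo_mem_nhdsGT hδ] with h hh
  have hpos : 0 < h := hh.1
  -- Normalized Lebesgue measure on (0,h] turns the Steklov error into a mean of translation errors.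
  -- Jensen and Tonelli then bound it by the largest translation error with r ≤ h < δ.
  set ν : Measure ℝ := (ENNReal.ofReal h)⁻¹ • volume.restrict (Ioc 0 h) with hν
  have hprob : IsProbabilityMeasure ν := by
    constructor
    simp only [hν, Measure.smul_apply, Measure.restrict_apply_univ, Real.volume_Ioc, sub_zero,
      smul_eq_mul]
    exact ENNReal.inv_mul_cancel (by simpa using hpos) ENNReal.ofReal_ne_top
  have hA : ∀ t, h⁻¹ • (∫ r in t..t + h, U r) - U t = ∫ r, (U (r + t) - U t) ∂ν := by
    intro t
    have hi : Integrable (fun r => U (r + t)) ν := by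
      refine Integrable.smul_measure ?_ (by simpa using hpos)
      have := (hU.intervalIntegrable (0 + t) (h + t)).comp_add_right t
      simp only [add_sub_cancel_right] at this
      exact (intervalIntegrable_iff_integrableOn_Ioc_of_le hpos.le).1 this
    rw [integral_sub hi (integrable_const _)]
    simp only [integral_const, probReal_univ, one_smul]
    congr 1
    rw [hν, integral_smul_measure, ← intervalIntegral.integral_of_le hpos.le,
      intervalIntegral.integral_comp_add_right]
    simp [hpos.le, add_comm]
  have hmeas : StronglyMeasurable (fun x : ℝ × ℝ => U (x.2 + x.1) - U x.1) :=
    (hUm.comp_measurable (measurable_snd.add measurable_fst)).sub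
      (hUm.comp_measurable measurable_fst)
  have hsq : eLpNorm (fun t => h⁻¹ • (∫ r in t..t + h, U r) - U t) 2 ^ 2 ≤ ε ^ 2 := by
    rw [eLpNorm_two_sq]
    calc ∫⁻ t, ‖h⁻¹ • (∫ r in t..t + h, U r) - U t‖ₑ ^ 2
        ≤ ∫⁻ t, ∫⁻ r, ‖U (r + t) - U t‖ₑ ^ 2 ∂ν := by
          refine lintegral_mono fun t => ?_
          rw [hA]
          exact enorm_integral_sq_le_lintegral
            (hmeas.comp_measurable measurable_prodMk_left).aestronglyMeasurable
      _ = ∫⁻ r, (∫⁻ t, ‖U (r + t) - U t‖ₑ ^ 2) ∂ν := by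
          exact lintegral_lintegral_swap (μ := volume) (ν := ν) (f := fun t r => ‖U (r + t) - U t‖ₑ ^ 2)
            (hmeas.enorm.pow_const 2).aemeasurable
      _ ≤ ∫⁻ _, ε ^ 2 ∂ν := by
          have hmem : ∀ᵐ r ∂ν, r ∈ Ioc 0 h :=
            Measure.ae_smul_measure (ae_restrict_mem measurableSet_Ioc) _
          refine lintegral_mono_ae ?_
          filter_upwards [hmem] with r hr
          rw [← eLpNorm_two_sq]
          refine pow_le_pow_left' (hδ' ?_) 2
          rw [Real.dist_eq, sub_zero, abs_of_pos hr.1]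
          exact hr.2.trans_lt hh.2
      _ = ε ^ 2 := by simp
  exact (ENNReal.pow_right_strictMono two_ne_zero).le_iff_le.1 hsq

theorem tendsto_eLpNorm_add_const_sub {E : Type*} [NormedAddCommGroup E] {U : ℝ → E}
    (hU : MemLp U 2) :
    Tendsto (fun h : ℝ => eLpNorm (fun t => U (t + h) - U t) 2) (𝓝[>] 0) (𝓝 0) := by
  simpa only [add_comm] using (tendsto_eLpNorm_comp_const_add_sub (by norm_num) (by norm_num)
    hU).mono_left nhdsWithin_le_nhds

/-! ### Bilinear pairings of L² functions -/

section Pairing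

variable {α ι E F : Type*} [MeasurableSpace α] {μ : Measure α}
  [NormedAddCommGroup E] [NormedSpace ℝ E] [NormedAddCommGroup F] [NormedSpace ℝ F]

theorem MeasureTheory.MemLp.integrable_bilin (B : E →L[ℝ] F →L[ℝ] ℝ) {U : α → E} {W : α → F}
    (hU : MemLp U 2 μ) (hW : MemLp W 2 μ) : Integrable (fun t => B (U t) (W t)) μ := by
  rw [← memLp_one_iff_integrable]
  refine MemLp.of_bilin (fun u w => B u w) ‖B‖₊ hU hW
    (B.aestronglyMeasurable_comp₂ hU.1 hW.1) (Eventually.of_forall fun t => ?_)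
  exact B.le_opNorm₂ _ _

theorem eLpNorm_bilin_le (B : E →L[ℝ] F →L[ℝ] ℝ) {U : α → E} {W : α → F}
    (hU : AEStronglyMeasurable U μ) (hW : AEStronglyMeasurable W μ) :
    eLpNorm (fun t => B (U t) (W t)) 1 μ ≤ ‖B‖₊ * eLpNorm U 2 μ * eLpNorm W 2 μ :=
  eLpNorm_le_eLpNorm_mul_eLpNorm_of_nnnorm hU hW (fun u w => B u w) ‖B‖₊
    (Eventually.of_forall fun _ => B.le_opNorm₂ _ _)

/-- A continuous bilinear pairing of two `L²`-convergent families converges in the mean. -/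
theorem tendsto_integral_bilin (B : E →L[ℝ] F →L[ℝ] ℝ) {l : Filter ι} {U : α → E} {W : α → F}
    (hU : MemLp U 2 μ) (hW : MemLp W 2 μ) {Us : ι → α → E} {Ws : ι → α → F}
    (hUs : ∀ i, AEStronglyMeasurable (Us i) μ) (hWs : ∀ i, AEStronglyMeasurable (Ws i) μ)
    (hUl : Tendsto (fun i => eLpNorm (fun t => Us i t - U t) 2 μ) l (𝓝 0))
    (hWl : Tendsto (fun i => eLpNorm (fun t => Ws i t - W t) 2 μ) l (𝓝 0)) :
    (∀ᶠ i in l, Integrable (fun t => B (Us i t) (Ws i t)) μ) ∧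
    Tendsto (fun i => ∫ t, B (Us i t) (Ws i t) ∂μ) l (𝓝 (∫ t, B (U t) (W t) ∂μ)) := by
  have hI : ∀ᶠ i in l, Integrable (fun t => B (Us i t) (Ws i t)) μ := by
    filter_upwards [hUl.eventually (gt_mem_nhds ENNReal.zero_lt_top),
      hWl.eventually (gt_mem_nhds ENNReal.zero_lt_top)] with i h1 h2
    have m1 : MemLp (Us i) 2 μ := by
      have : MemLp (fun t => Us i t - U t) 2 μ := ⟨(hUs i).sub hU.1, h1⟩
      convert! this.add hU using 1
      ext t; simp
    have m2 : MemLp (Ws i) 2 μ := by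
      have : MemLp (fun t => Ws i t - W t) 2 μ := ⟨(hWs i).sub hW.1, h2⟩
      convert! this.add hW using 1
      ext t; simp
    exact m1.integrable_bilin B m2
  refine ⟨hI, tendsto_integral_of_L1' _ (hU.integrable_bilin B hW).1 hI ?_⟩
  have hbound : ∀ i, eLpNorm ((fun t => B (Us i t) (Ws i t)) - fun t => B (U t) (W t)) 1 μ ≤
      ‖B‖₊ * eLpNorm (fun t => Us i t - U t) 2 μ * eLpNorm (fun t => Ws i t - W t) 2 μ +
      ‖B‖₊ * eLpNorm (fun t => Us i t - U t) 2 μ * eLpNorm W 2 μ +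
      ‖B‖₊ * eLpNorm U 2 μ * eLpNorm (fun t => Ws i t - W t) 2 μ := by
    intro i
    have mU := (hUs i).sub hU.1
    have mW := (hWs i).sub hW.1
    -- Every term of this expansion contains at least one factor that tends to zero in L².
    have e : ((fun t => B (Us i t) (Ws i t)) - fun t => B (U t) (W t)) =
        ((fun t => B (Us i t - U t) (Ws i t - W t)) + fun t => B (Us i t - U t) (W t)) +
        fun t => B (U t) (Ws i t - W t) := by
      ext t; simp; ring
    rw [e]
    refine (eLpNorm_add_le ((B.aestronglyMeasurable_comp₂ mU mW).add
      (B.aestronglyMeasurable_comp₂ mU hW.1)) (B.aestronglyMeasurable_comp₂ hU.1 mW)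
      le_rfl).trans ?_
    refine add_le_add ((eLpNorm_add_le (B.aestronglyMeasurable_comp₂ mU mW)
      (B.aestronglyMeasurable_comp₂ mU hW.1) le_rfl).trans
      (add_le_add (eLpNorm_bilin_le B mU mW) (eLpNorm_bilin_le B mU hW.1)))
      (eLpNorm_bilin_le B hU.1 mW)
  refine tendsto_of_tendsto_of_tendsto_of_le_of_le tendsto_const_nhds ?_ (fun _ => zero_le) hbound
  have t1 : Tendsto (fun i => (‖B‖₊ : ℝ≥0∞) * eLpNorm (fun t => Us i t - U t) 2 μ) l (𝓝 0) := by
    simpa using ENNReal.Tendsto.const_mul hUl (Or.inr ENNReal.coe_ne_top)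
  have t2 := ENNReal.Tendsto.mul t1 (Or.inr ENNReal.zero_ne_top) hWl (Or.inr ENNReal.zero_ne_top)
  have t3 := ENNReal.Tendsto.mul_const (b := eLpNorm W 2 μ) t1 (Or.inr hW.2.ne)
  have t4 := ENNReal.Tendsto.const_mul (a := (‖B‖₊ : ℝ≥0∞) * eLpNorm U 2 μ) hWl
    (Or.inr (ENNReal.mul_ne_top ENNReal.coe_ne_top hU.2.ne))
  simpa using (t2.add t3).add t4

end Pairing

/-! ### Weak derivatives and primitives -/

section

variable {X : Type*} [NormedAddCommGroup X] [NormedSpace ℝ X]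

theorem MeasureTheory.LocallyIntegrableOn.integrable_smul_of_tsupport_subset {U : Set ℝ}
    {f : ℝ → X} (hf : LocallyIntegrableOn f U) {φ : ℝ → ℝ} (hφ : Continuous φ)
    (hc : HasCompactSupport φ) (hs : tsupport φ ⊆ U) : Integrable (fun t => φ t • f t) := by
  have h1 : IntegrableOn (fun t => φ t • f t) (tsupport φ) :=
    (hf.integrableOn_compact_subset hs hc).continuousOn_smul hφ.continuousOn hc
  refine h1.integrable_of_forall_notMem_eq_zero fun t ht => ?_
  rw [image_eq_zero_of_notMem_tsupport ht, zero_smul]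

theorem setIntegral_smul_eq_integral_of_tsupport_subset {U : Set ℝ} (f : ℝ → X) {φ : ℝ → ℝ}
    (hs : tsupport φ ⊆ U) : ∫ t in U, φ t • f t = ∫ t, φ t • f t := by
  refine setIntegral_eq_integral_of_forall_compl_eq_zero fun t ht => ?_
  rw [image_eq_zero_of_notMem_tsupport fun h => ht (hs h), zero_smul]

theorem tsupport_deriv_subset_of_subset {φ : ℝ → ℝ} {U : Set ℝ} (hs : tsupport φ ⊆ U) :
    tsupport (deriv φ) ⊆ U :=
  (closure_minimal (support_deriv_subset) (isClosed_tsupport φ)).trans hs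

/-- The weak derivative is unique up to a null set. -/
theorem IsWeakDeriv.ae_eq [CompleteSpace X] {T : ℝ} {u u₁ u₂ : ℝ → X}
    (h₁ : IsWeakDeriv T u u₁) (h₂ : IsWeakDeriv T u u₂) :
    ∀ᵐ t ∂(volume.restrict (Ioo 0 T)), u₁ t = u₂ t := by
  rw [ae_restrict_iff' measurableSet_Ioo]
  have := isOpen_Ioo.ae_eq_zero_of_integral_contDiff_smul_eq_zero (μ := volume)
    (f := fun t => u₁ t - u₂ t)
    (h₁.locallyIntegrable_deriv.sub h₂.locallyIntegrable_deriv) fun φ hφ hc hs => by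
      have e := (h₁.integral_eq φ hφ hc hs).symm.trans (h₂.integral_eq φ hφ hc hs)
      rw [setIntegral_smul_eq_integral_of_tsupport_subset _ hs,
        setIntegral_smul_eq_integral_of_tsupport_subset _ hs, neg_inj] at e
      simp only [smul_sub]
      rw [integral_sub (h₁.locallyIntegrable_deriv.integrable_smul_of_tsupport_subset
        hφ.continuous hc hs) (h₂.locallyIntegrable_deriv.integrable_smul_of_tsupport_subset
        hφ.continuous hc hs), e, sub_self]
  filter_upwards [this] with t ht htm using sub_eq_zero.1 (ht htm)

/-- A smooth function with compact support in `(0,T)` and vanishing integral is the derivative of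
a smooth function with compact support in `(0,T)`. -/
theorem exists_contDiff_deriv_eq_of_integral_eq_zero {T : ℝ} {χ : ℝ → ℝ}
    (hχ : ContDiff ℝ ∞ χ) (hc : HasCompactSupport χ) (hs : tsupport χ ⊆ Ioo 0 T)
    (hi : ∫ t, χ t = 0) : ∃ φ : ℝ → ℝ, ContDiff ℝ ∞ φ ∧ HasCompactSupport φ ∧
      tsupport φ ⊆ Ioo 0 T ∧ deriv φ = χ := by
  have hcont := hχ.continuous
  have hd : ∀ t, HasDerivAt (fun t => ∫ r in (0 : ℝ)..t, χ r) (χ t) t := fun t =>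
    hcont.integral_hasStrictDerivAt 0 t |>.hasDerivAt
  have hderiv : deriv (fun t => ∫ r in (0 : ℝ)..t, χ r) = χ := funext fun t => (hd t).deriv
  -- The order of a and b is not imposed, so an empty support can take a = 1, b = T - 1.
  obtain ⟨a, b, ha, hb, hab⟩ : ∃ a b : ℝ, 0 < a ∧ b < T ∧ tsupport χ ⊆ Icc a b := by
    rcases (tsupport χ).eq_empty_or_nonempty with he | hne
    · exact ⟨1, T - 1, one_pos, by linarith, by simp [he]⟩
    · obtain ⟨a, ha⟩ := IsCompact.exists_isLeast hc hne
      obtain ⟨b, hb⟩ := IsCompact.exists_isGreatest hc hne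
      exact ⟨a, b, (hs ha.1).1, (hs hb.1).2, fun t ht => ⟨ha.2 ht, hb.2 ht⟩⟩
  have hz : ∀ t, t ∉ Icc a b → χ t = 0 := fun t ht =>
    image_eq_zero_of_notMem_tsupport fun h => ht (hab h)
  have hsupp : Function.support (fun t => ∫ r in (0 : ℝ)..t, χ r) ⊆ Icc a b := by
    intro t ht
    by_contra hn
    apply ht
    rcases lt_or_ge t a with h | h
    · refine intervalIntegral.integral_zero_ae (Eventually.of_forall fun r hr => hz r fun h' => ?_)
      have := hr.2.trans_lt (max_lt ha h)
      exact absurd h'.1 (not_le.2 this)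
    -- Beyond b the primitive has collected the whole integral of χ, which is zero.
    · have hbt : b < t := by
        by_contra hbt
        exact hn ⟨h, not_lt.1 hbt⟩
      change ∫ r in (0 : ℝ)..t, χ r = 0
      refine Eq.trans ?_ hi
      refine intervalIntegral.integral_eq_integral_of_support_subset fun r hr => ?_
      have := hab (subset_tsupport _ hr)
      exact ⟨ha.trans_le this.1, this.2.trans hbt.le⟩
  have hts : tsupport (fun t => ∫ r in (0 : ℝ)..t, χ r) ⊆ Icc a b :=
    closure_minimal hsupp isClosed_Icc
  refine ⟨fun t => ∫ r in (0 : ℝ)..t, χ r, ?_, ?_, ?_, hderiv⟩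
  · rw [contDiff_infty_iff_deriv, hderiv]
    exact ⟨fun t => (hd t).differentiableAt, hχ⟩
  · exact HasCompactSupport.of_support_subset_isCompact isCompact_Icc hsupp
  · exact hts.trans fun t ht => ⟨ha.trans_le ht.1, ht.2.trans_lt hb⟩

/-- The du Bois-Reymond lemma on `(0,T)`. -/
theorem ae_eq_const_of_integral_deriv_smul_eq_zero [CompleteSpace X] {T : ℝ} (hT : 0 < T)
    {w : ℝ → X} (hw : LocallyIntegrableOn w (Ioo 0 T))
    (h : ∀ φ : ℝ → ℝ, ContDiff ℝ ∞ φ → HasCompactSupport φ → tsupport φ ⊆ Ioo 0 T →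
      ∫ t, deriv φ t • w t = 0) :
    ∃ c : X, ∀ᵐ t ∂(volume.restrict (Ioo 0 T)), w t = c := by
  -- The outer radius T/4 keeps the normalized bump θ supported inside (0,T).
  let β : ContDiffBump (T / 2) := ⟨T / 8, T / 4, by positivity, by linarith⟩
  let θ : ℝ → ℝ := β.normed volume
  have hθ : ContDiff ℝ ∞ θ := β.contDiff_normed
  have hθc : HasCompactSupport θ := β.hasCompactSupport_normed
  have hθs : tsupport θ ⊆ Ioo 0 T := by
    rw [β.tsupport_normed_eq]
    intro t ht
    rw [Metric.mem_closedBall, Real.dist_eq, abs_le] at ht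
    have : β.rOut = T / 4 := rfl
    rw [this] at ht
    constructor <;> linarith [ht.1, ht.2]
  have hθi : ∫ t, θ t = 1 := β.integral_normed
  refine ⟨∫ t, θ t • w t, ?_⟩
  set c := ∫ t, θ t • w t with hcdef
  rw [ae_restrict_iff' measurableSet_Ioo]
  have := isOpen_Ioo.ae_eq_zero_of_integral_contDiff_smul_eq_zero (μ := volume)
    (f := fun t => w t - c)
    (hw.sub ((locallyIntegrable_const c).locallyIntegrableOn _)) fun ψ hψ hψc hψs => by
      set m := ∫ t, ψ t with hm
      have hψint : Integrable ψ := hψ.continuous.integrable_of_hasCompactSupport hψc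
      have hθint : Integrable θ := hθ.continuous.integrable_of_hasCompactSupport hθc
      have hsub : tsupport (fun t => ψ t - m * θ t) ⊆ tsupport ψ ∪ tsupport θ := by
        refine closure_minimal (fun t ht => ?_)
          ((isClosed_tsupport ψ).union (isClosed_tsupport θ))
        by_contra hn
        rw [mem_union, not_or] at hn
        apply ht
        simp [image_eq_zero_of_notMem_tsupport hn.1, image_eq_zero_of_notMem_tsupport hn.2]
      -- Subtracting m θ removes the mean of ψ, so the difference is an admissible φ'. Testing with
      -- it gives ∫ ψ w = m c = ∫ ψ c.
      obtain ⟨φ, hφ, hφc, hφs, hφd⟩ := exists_contDiff_deriv_eq_of_integral_eq_zero (T := T)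
        (χ := fun t => ψ t - m * θ t) (hψ.sub (contDiff_const.mul hθ))
        (HasCompactSupport.of_support_subset_isCompact (IsCompact.union hψc hθc)
          ((subset_tsupport _).trans hsub))
        (hsub.trans (union_subset hψs hθs))
        (by rw [integral_sub hψint (hθint.const_mul m), integral_const_mul, hθi, ← hm]; ring)
      have h0 := h φ hφ hφc hφs
      have i1 := hw.integrable_smul_of_tsupport_subset hψ.continuous hψc hψs
      have i2 := hw.integrable_smul_of_tsupport_subset hθ.continuous hθc hθs
      rw [hφd] at h0
      simp only [sub_smul, mul_smul] at h0
      have i3 : Integrable (fun t => m • θ t • w t) := i2.smul m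
      rw [integral_sub i1 i3, integral_smul, ← hcdef] at h0
      simp only [smul_sub]
      rw [integral_sub i1 (hψint.smul_const c), integral_smul_const, ← hm, h0]
  filter_upwards [this] with t ht htm using sub_eq_zero.1 (ht htm)

/-- Integration by parts of the primitive of an integrable function against a test function. -/
theorem integral_deriv_smul_primitive [CompleteSpace X] {T : ℝ} (hT : 0 < T) {p : ℝ → X}
    (hp : IntervalIntegrable p volume 0 T) {φ : ℝ → ℝ} (hφ : ContDiff ℝ ∞ φ)
    (h0 : φ 0 = 0) (h1 : φ T = 0) :
    ∫ t in (0 : ℝ)..T, deriv φ t • (∫ r in (0 : ℝ)..t, p r) =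
      -∫ t in (0 : ℝ)..T, φ t • p t := by
  have hφd : Continuous (deriv φ) := hφ.continuous_deriv (by simp)
  have hpi : IntegrableOn p (uIcc 0 T) := by
    rw [uIcc_of_le hT.le]
    exact (intervalIntegrable_iff_integrableOn_Icc_of_le hT.le).1 hp
  have hPc : ContinuousOn (fun t => ∫ r in (0 : ℝ)..t, p r) (uIcc 0 T) :=
    intervalIntegral.continuousOn_primitive_interval hpi
  -- Continuous functionals reduce the claim to scalar integration by parts for absolutely
  -- continuous functions.
  refine SeparatingDual.eq_iff_forall_dual_eq (R := ℝ).2 fun ℓ => ?_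
  have hℓ : IntervalIntegrable (fun t => ℓ (p t)) volume 0 T := by
    rw [intervalIntegrable_iff] at hp ⊢
    exact ℓ.integrable_comp hp
  have hsub : ∀ t ∈ uIcc 0 T, IntervalIntegrable p volume 0 t := fun t ht =>
    hp.mono_set (uIcc_subset_uIcc_left ht)
  have hdP : IntervalIntegrable (fun t => deriv φ t • ∫ r in (0 : ℝ)..t, p r) volume 0 T :=
    (hφd.continuousOn.smul hPc).intervalIntegrable
  rw [map_neg, ← ℓ.intervalIntegral_comp_comm (hp.continuousOn_smul hφ.continuous.continuousOn),
    ← ℓ.intervalIntegral_comp_comm hdP]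
  have hac : AbsolutelyContinuousOnInterval φ 0 T :=
    (hφ.of_le (by simp)).contDiffOn.absolutelyContinuousOnInterval
  have hac2 := hℓ.absolutelyContinuousOnInterval_intervalIntegral (c := 0) left_mem_uIcc
  have key := hac.integral_mul_deriv_eq_deriv_mul hac2
  rw [h0, h1] at key
  have e1 : ∫ t in (0 : ℝ)..T, φ t * deriv (fun x => ∫ r in (0 : ℝ)..x, ℓ (p r)) t =
      ∫ t in (0 : ℝ)..T, ℓ (φ t • p t) := by
    refine intervalIntegral.integral_congr_ae ?_
    filter_upwards [hℓ.ae_hasDerivAt_integral] with t ht htm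
    rw [(ht (uIoc_subset_uIcc htm) 0 left_mem_uIcc).deriv, map_smul, smul_eq_mul]
  have e2 : ∫ t in (0 : ℝ)..T, ℓ (deriv φ t • ∫ r in (0 : ℝ)..t, p r) =
      ∫ t in (0 : ℝ)..T, deriv φ t * ∫ r in (0 : ℝ)..t, ℓ (p r) := by
    refine intervalIntegral.integral_congr fun t ht => ?_
    simp only [map_smul, smul_eq_mul]
    rw [← ℓ.intervalIntegral_comp_comm (hsub t ht)]
  rw [← e1, e2, key]
  ring

/-- The difference between u and the primitive of p has zero weak derivative, hence is a.e. constant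
by du Bois-Reymond. -/
theorem IsWeakDeriv.exists_primitive [CompleteSpace X] {T : ℝ} (hT : 0 < T) {u p : ℝ → X}
    (h : IsWeakDeriv T u p) (hp : IntervalIntegrable p volume 0 T) :
    ∃ w : ℝ → X, IsContRepr T u w ∧
      ∀ s ∈ Icc 0 T, ∀ t ∈ Icc 0 T, w t - w s = ∫ r in s..t, p r := by
  have hpi : IntegrableOn p (uIcc 0 T) := by
    rw [uIcc_of_le hT.le]
    exact (intervalIntegrable_iff_integrableOn_Icc_of_le hT.le).1 hp
  have hPc : ContinuousOn (fun t => ∫ r in (0 : ℝ)..t, p r) (Icc 0 T) := by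
    rw [← uIcc_of_le hT.le]
    exact intervalIntegral.continuousOn_primitive_interval hpi
  have hPl : LocallyIntegrableOn (fun t => ∫ r in (0 : ℝ)..t, p r) (Ioo 0 T) :=
    (hPc.mono Ioo_subset_Icc_self).locallyIntegrableOn measurableSet_Ioo
  obtain ⟨c, hc⟩ := ae_eq_const_of_integral_deriv_smul_eq_zero hT
    (w := fun t => u t - ∫ r in (0 : ℝ)..t, p r) (h.locallyIntegrable.sub hPl)
    fun φ hφ hφc hφs => by
      have hφd : Continuous (deriv φ) := hφ.continuous_deriv (by simp)
      have hsd := tsupport_deriv_subset_of_subset hφs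
      have z : ∀ t, t ∉ Ioo 0 T → φ t = 0 := fun t ht =>
        image_eq_zero_of_notMem_tsupport fun h' => ht (hφs h')
      simp only [smul_sub]
      rw [integral_sub (h.locallyIntegrable.integrable_smul_of_tsupport_subset hφd hφc.deriv hsd)
        (hPl.integrable_smul_of_tsupport_subset hφd hφc.deriv hsd),
        ← setIntegral_smul_eq_integral_of_tsupport_subset u hsd,
        ← setIntegral_smul_eq_integral_of_tsupport_subset _ hsd, h.integral_eq φ hφ hφc hφs]
      have key := integral_deriv_smul_primitive hT hp hφ (z 0 (by simp)) (z T (by simp))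
      rw [intervalIntegral.integral_of_le hT.le, intervalIntegral.integral_of_le hT.le,
        integral_Ioc_eq_integral_Ioo, integral_Ioc_eq_integral_Ioo] at key
      rw [key, sub_self]
  refine ⟨fun t => c + ∫ r in (0 : ℝ)..t, p r, ⟨continuousOn_const.add hPc, ?_⟩, ?_⟩
  · filter_upwards [hc] with t ht
    rw [← ht]; abel
  · intro s hs t ht
    have hi : ∀ t ∈ Icc 0 T, IntervalIntegrable p volume 0 t := fun t ht =>
      hp.mono_set (uIcc_subset_uIcc_left (by rwa [uIcc_of_le hT.le]))
    simp only [add_sub_add_left_eq_sub]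
    exact intervalIntegral.integral_interval_sub_left (hi t ht) (hi s hs)

end

/-! ### Hölder-1/2 bounds and equality at a point -/

/-- Cauchy–Schwarz, with C the squared L² norm of U. -/
theorem exists_norm_intervalIntegral_sq_le {X : Type*} [NormedAddCommGroup X] [NormedSpace ℝ X]
    {U : ℝ → X} (hU : MemLp U 2) :
    ∃ C : ℝ, ∀ s t : ℝ, ‖∫ r in s..t, U r‖ ^ 2 ≤ C * |t - s| := by
  set M := (eLpNorm U 2).toReal with hM
  refine ⟨M ^ 2, fun s t => ?_⟩
  have h1 : ‖∫ r in s..t, U r‖ₑ ≤ ENNReal.ofReal (M * √|t - s|) := by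
    calc ‖∫ r in s..t, U r‖ₑ ≤ ∫⁻ r in uIoc s t, ‖U r‖ₑ := by
          rw [← ofReal_norm, intervalIntegral.norm_intervalIntegral_eq,
            ofReal_norm]
          exact enorm_integral_le_lintegral_enorm _
      _ = eLpNorm U 1 (volume.restrict (uIoc s t)) := by rw [eLpNorm_one_eq_lintegral_enorm]
      _ ≤ eLpNorm U 2 (volume.restrict (uIoc s t)) *
            (volume.restrict (uIoc s t)) univ ^
              (1 / (1 : ℝ≥0∞).toReal - 1 / (2 : ℝ≥0∞).toReal) :=
          eLpNorm_le_eLpNorm_mul_rpow_measure_univ (by norm_num) hU.1.restrict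
      _ ≤ eLpNorm U 2 * ENNReal.ofReal |t - s| ^ (1 / 2 : ℝ) := by
          gcongr
          · exact Measure.restrict_le_self
          · rw [Measure.restrict_apply_univ, Real.volume_uIoc]
            norm_num
      _ = ENNReal.ofReal (M * √|t - s|) := by
          rw [ENNReal.ofReal_mul ENNReal.toReal_nonneg, ENNReal.ofReal_toReal hU.2.ne,
            Real.sqrt_eq_rpow, ENNReal.ofReal_rpow_of_nonneg (abs_nonneg _) (by norm_num)]
  have h2 : ‖∫ r in s..t, U r‖ ≤ M * √|t - s| := by
    rw [← ofReal_norm] at h1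
    exact (ENNReal.ofReal_le_ofReal_iff (by positivity)).1 h1
  calc ‖∫ r in s..t, U r‖ ^ 2 ≤ (M * √|t - s|) ^ 2 := by gcongr
    _ = M ^ 2 * |t - s| := by rw [mul_pow, Real.sq_sqrt (abs_nonneg _)]

/-- Two continuous functions agree at `t` if the square of their difference is dominated by
`|s - t|` times an integrable function. -/
theorem eq_of_sq_sub_le_abs_sub_mul {T : ℝ} (hT : 0 < T) {g k q : ℝ → ℝ} {C : ℝ}
    (hg : ContinuousOn g (Icc 0 T)) (hk : ContinuousOn k (Icc 0 T)) (hq : Integrable q)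
    {t : ℝ} (ht : t ∈ Icc 0 T)
    (h : ∀ᵐ s, s ∈ Ioo 0 T → (g s - k s) ^ 2 ≤ C * |s - t| * q s) : g t = k t := by
  by_contra hne
  set e := (g t - k t) ^ 2 with he
  have hepos : 0 < e := by have := sub_ne_zero.2 hne; positivity
  have hcont : ContinuousWithinAt (fun s => (g s - k s) ^ 2) (Icc 0 T) t :=
    ((hg.sub hk).pow 2) t ht
  have hev := hcont.eventually (lt_mem_nhds (show e / 2 < (g t - k t) ^ 2 by rw [← he]; linarith))
  obtain ⟨δ, hδ, hball⟩ := Metric.mem_nhdsWithin_iff.1 hev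
  -- A second endpoint near t inside [0,T]: to the right of t, or to the left when t = T.
  obtain ⟨d, hd, hdt, hdδ⟩ : ∃ d ∈ Icc 0 T, d ≠ t ∧ |d - t| < δ := by
    rcases ht.2.lt_or_eq with h1 | h1
    · refine ⟨min T (t + δ / 2), ⟨by have := ht.1; positivity, min_le_left _ _⟩, ?_, ?_⟩
      · exact (lt_min h1 (by linarith)).ne'
      · have h2 : t < min T (t + δ / 2) := lt_min h1 (by linarith)
        rw [abs_of_pos (by linarith)]
        linarith [min_le_right T (t + δ / 2)]
    · refine ⟨max 0 (t - δ / 2), ⟨le_max_left _ _, max_le hT.le (by linarith)⟩, ?_, ?_⟩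
      · exact (max_lt (by linarith) (by linarith)).ne
      · have h2 : max 0 (t - δ / 2) < t := max_lt (by linarith) (by linarith)
        rw [abs_of_neg (by linarith)]
        linarith [le_max_right 0 (t - δ / 2)]
  -- Between t and d the squared difference exceeds e/2, so 1/|s - t| ≤ (2C/e) q(s), contradicting
  -- the non-integrability of 1/(s - t) at t.
  have hint : IntervalIntegrable (fun s => (s - t)⁻¹) volume t d := by
    refine IntervalIntegrable.mono_fun' (g := fun s => 2 * C / e * q s)
      ((hq.const_mul _).intervalIntegrable) (by fun_prop) ?_
    rw [EventuallyLE, ae_restrict_iff' measurableSet_uIoc]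
    have n0 : ∀ᵐ s : ℝ, s ≠ 0 := by simp [ae_iff, measure_singleton]
    have nT : ∀ᵐ s : ℝ, s ≠ T := by simp [ae_iff, measure_singleton]
    have nt : ∀ᵐ s : ℝ, s ≠ t := by simp [ae_iff, measure_singleton]
    filter_upwards [h, n0, nT, nt] with s hs hs0 hsT hst hsm
    have hs1 : s ∈ uIcc t d := uIoc_subset_uIcc hsm
    have hs2 : s ∈ Icc 0 T := by
      have := uIcc_subset_Icc ht hd
      exact this hs1
    have hs3 : s ∈ Metric.ball t δ := by
      rw [Metric.mem_ball, Real.dist_eq]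
      exact (abs_sub_left_of_mem_uIcc hs1).trans_lt hdδ
    have hlow : e / 2 < (g s - k s) ^ 2 := hball ⟨hs3, hs2⟩
    have hup := hs ⟨lt_of_le_of_ne hs2.1 hs0.symm, lt_of_le_of_ne hs2.2 hsT⟩
    have hpos : 0 < |s - t| := abs_pos.2 (sub_ne_zero.2 hst)
    rw [norm_inv, Real.norm_eq_abs, inv_le_iff_one_le_mul₀ hpos, div_mul_eq_mul_div,
      div_mul_eq_mul_div, le_div_iff₀ hepos]
    nlinarith
  rw [intervalIntegrable_sub_inv_iff] at hint
  exact hint.elim (fun h => hdt h.symm) fun h => h left_mem_uIcc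

/-! ### From the difference rule to the integral identity -/

theorem continuous_steklov {E : Type*} [NormedAddCommGroup E] [NormedSpace ℝ E] {U : ℝ → E}
    (hU : MemLp U 2) (h : ℝ) : Continuous (fun t => h⁻¹ • ∫ r in t..t + h, U r) := by
  have hP := intervalIntegral.continuous_primitive (fun a b => hU.intervalIntegrable a b) 0
  have e : (fun t => h⁻¹ • ∫ r in t..t + h, U r) =
      fun t => h⁻¹ • ((∫ r in (0 : ℝ)..t + h, U r) - ∫ r in (0 : ℝ)..t, U r) := by
    funext t
    rw [intervalIntegral.integral_interval_sub_left (hU.intervalIntegrable _ _)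
      (hU.intervalIntegrable _ _)]
  rw [e]
  exact ((hP.comp (continuous_add_const h)).sub hP).const_smul _

theorem tendsto_eLpNorm_restrict {E ι : Type*} [NormedAddCommGroup E] {l : Filter ι}
    {D : ι → ℝ → E} (s : Set ℝ) (hD : Tendsto (fun i => eLpNorm (D i) 2) l (𝓝 0)) :
    Tendsto (fun i => eLpNorm (D i) 2 (volume.restrict s)) l (𝓝 0) :=
  tendsto_of_tendsto_of_tendsto_of_le_of_le tendsto_const_nhds hD
    (fun _ => zero_le) fun _ => eLpNorm_mono_measure _ Measure.restrict_le_self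

/-- Passage to the limit in a difference product rule, at Lebesgue points. -/
theorem exists_ae_sub_eq_integral_of_difference {E₁ F₁ E₂ F₂ : Type*}
    [NormedAddCommGroup E₁] [NormedSpace ℝ E₁] [CompleteSpace E₁]
    [NormedAddCommGroup F₁] [NormedSpace ℝ F₁]
    [NormedAddCommGroup E₂] [NormedSpace ℝ E₂] [CompleteSpace E₂]
    [NormedAddCommGroup F₂] [NormedSpace ℝ F₂]
    (B₁ : E₁ →L[ℝ] F₁ →L[ℝ] ℝ) (B₂ : E₂ →L[ℝ] F₂ →L[ℝ] ℝ) {T : ℝ} {f : ℝ → ℝ}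
    {U₁ : ℝ → E₁} {W₁ : ℝ → F₁} {U₂ : ℝ → E₂} {W₂ : ℝ → F₂} (hf : Integrable f)
    (mU₁ : StronglyMeasurable U₁) (mW₁ : StronglyMeasurable W₁) (mU₂ : StronglyMeasurable U₂)
    (hU₁ : MemLp U₁ 2) (hW₁ : MemLp W₁ 2) (hU₂ : MemLp U₂ 2) (hW₂ : MemLp W₂ 2)
    (h : ∀ h > 0, ∀ᵐ t, t ∈ Ioo 0 (T - h) → f (t + h) - f t =
      B₁ (∫ r in t..t + h, U₁ r) (W₁ (t + h)) + B₂ (∫ r in t..t + h, U₂ r) (W₂ t)) :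
    ∃ S : Set ℝ, (∀ᵐ t, t ∈ S) ∧ ∀ a ∈ S, ∀ b ∈ S, 0 < a → a ≤ b → b < T →
      f b - f a = ∫ t in a..b, (B₁ (U₁ t) (W₁ t) + B₂ (U₂ t) (W₂ t)) := by
  refine ⟨{x | HasDerivAt (fun x => ∫ t in (0 : ℝ)..x, f t) (f x) x}, ?_, ?_⟩
  · filter_upwards [LocallyIntegrable.ae_hasDerivAt_integral hf.locallyIntegrable] with x hx using hx 0
  intro a ha b hb ha0 hab hbT
  have hfi : ∀ x y, IntervalIntegrable f volume x y := fun x y => hf.intervalIntegrable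
  -- The averages of f over [b,b+η] and [a,a+η] tend to f(b) and f(a); their difference is the
  -- integral over [a,b] of the difference quotient of f.
  have hlim := hb.tendsto_slope_zero_right.sub ha.tendsto_slope_zero_right
  refine tendsto_nhds_unique hlim ?_
  obtain ⟨i1, l1⟩ := tendsto_integral_bilin B₁ (hU₁.restrict (Ioc a b)) (hW₁.restrict (Ioc a b))
    (Us := fun h t => h⁻¹ • ∫ r in t..t + h, U₁ r) (Ws := fun h t => W₁ (t + h))
    (fun h => (continuous_steklov hU₁ h).aestronglyMeasurable)
    (fun h => (mW₁.comp_measurable (measurable_add_const h)).aestronglyMeasurable)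
    (tendsto_eLpNorm_restrict _ (tendsto_eLpNorm_steklov_sub mU₁ hU₁)) (tendsto_eLpNorm_restrict _ (tendsto_eLpNorm_add_const_sub hW₁))
  obtain ⟨i2, l2⟩ := tendsto_integral_bilin B₂ (hU₂.restrict (Ioc a b)) (hW₂.restrict (Ioc a b))
    (Us := fun h t => h⁻¹ • ∫ r in t..t + h, U₂ r) (Ws := fun _ t => W₂ t)
    (fun h => (continuous_steklov hU₂ h).aestronglyMeasurable) (fun h => hW₂.1.restrict)
    (tendsto_eLpNorm_restrict _ (tendsto_eLpNorm_steklov_sub mU₂ hU₂)) (by simp)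
  rw [intervalIntegral.integral_of_le hab, integral_add
    ((hU₁.restrict _).integrable_bilin B₁ (hW₁.restrict _))
    ((hU₂.restrict _).integrable_bilin B₂ (hW₂.restrict _))]
  refine (l1.add l2).congr' ?_
  filter_upwards [i1, i2, Ioo_mem_nhdsGT (sub_pos.2 hbT)] with η hi1 hi2 hη
  have hshift : IntervalIntegrable (fun t => f (t + η)) volume a b := by
    simpa using (hfi (a + η) (b + η)).comp_add_right η
  rw [← integral_add hi1 hi2]
  calc _ = ∫ t in a..b, η⁻¹ * (f (t + η) - f t) := by
        rw [intervalIntegral.integral_of_le hab]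
        refine integral_congr_ae ?_
        filter_upwards [ae_restrict_of_ae (h η hη.1), ae_restrict_mem measurableSet_Ioc]
          with t ht htm
        rw [ht ⟨ha0.trans htm.1, by linarith [htm.2, hη.2]⟩]
        simp [mul_add]
    _ = η⁻¹ * ((∫ t in a + η..b + η, f t) - ∫ t in a..b, f t) := by
        rw [intervalIntegral.integral_const_mul, intervalIntegral.integral_sub hshift (hfi _ _),
          intervalIntegral.integral_comp_add_right]
    _ = _ := by
        rw [← intervalIntegral.integral_interval_sub_left (hfi 0 (b + η)) (hfi 0 (a + η)),
          ← intervalIntegral.integral_interval_sub_left (hfi 0 b) (hfi 0 a)]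
        simp only [smul_eq_mul]
        ring

/-! ### Representatives on the whole line -/

/-- Extension by zero makes shifts and averages meaningful on all of ℝ; strong measurability
provides the joint measurability needed for Tonelli. -/
theorem MemL2.exists_stronglyMeasurable_memLp {X : Type*} [NormedAddCommGroup X] {T : ℝ}
    {u : ℝ → X} (hu : MemL2 T u) : ∃ U : ℝ → X, StronglyMeasurable U ∧ MemLp U 2 ∧
      ∀ᵐ t, t ∈ Ioo 0 T → U t = u t := by
  have hu' : MemLp u 2 (volume.restrict (Ioo 0 T)) := hu
  refine ⟨(Ioo 0 T).indicator (hu'.1.mk u),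
    hu'.1.stronglyMeasurable_mk.indicator measurableSet_Ioo, ?_, ?_⟩
  · exact (memLp_indicator_iff_restrict measurableSet_Ioo).2 (hu'.ae_eq hu'.1.ae_eq_mk)
  · have := (ae_restrict_iff' measurableSet_Ioo).1 hu'.1.ae_eq_mk
    filter_upwards [this] with t ht htm
    rw [indicator_of_mem htm, ← ht htm]

theorem MemH1.exists_contRepr {X : Type*} [NormedAddCommGroup X] [NormedSpace ℝ X]
    [CompleteSpace X] {T : ℝ} (hT : 0 < T) {u u' : ℝ → X} (hu : MemH1 T u)
    (hu' : IsWeakDeriv T u u') : ∃ (w : ℝ → X) (U : ℝ → X), IsContRepr T u w ∧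
      StronglyMeasurable U ∧ MemLp U 2 ∧ (∀ᵐ t, t ∈ Ioo 0 T → U t = u' t) ∧
      ∀ s ∈ Icc 0 T, ∀ t ∈ Icc 0 T, w t - w s = ∫ r in s..t, U r := by
  obtain ⟨-, p, hp, hup⟩ := hu
  obtain ⟨U, hUm, hU, hUp⟩ := hp.exists_stronglyMeasurable_memLp
  -- The given u' is not assumed square integrable; uniqueness identifies it with the L² derivative.
  have hU' : ∀ᵐ t, t ∈ Ioo 0 T → U t = u' t := by
    filter_upwards [hUp, (ae_restrict_iff' measurableSet_Ioo).1 (hup.ae_eq hu')] with t h1 h2 ht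
    rw [h1 ht, h2 ht]
  have hUw : IsWeakDeriv T u U := by
    refine ⟨hup.locallyIntegrable, (hU.locallyIntegrable (by norm_num)).locallyIntegrableOn _,
      fun φ hφ hc hs => ?_⟩
    rw [hu'.integral_eq φ hφ hc hs]
    congr 1
    refine setIntegral_congr_ae measurableSet_Ioo ?_
    filter_upwards [hU'] with t ht htm
    rw [ht htm]
  obtain ⟨w, hw, hinc⟩ := hUw.exists_primitive hT (hU.intervalIntegrable 0 T)
  exact ⟨w, U, hw, hUm, hU, hU', hinc⟩

/-! ### The product rule for (y,z) -/

theorem absolutelyContinuousOnInterval_const (c a b : ℝ) :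
    AbsolutelyContinuousOnInterval (fun _ => c) a b :=
  (LipschitzWith.const c).lipschitzOnWith.absolutelyContinuousOnInterval

theorem toDualOf_apply {V H : Type*} [NormedAddCommGroup V] [NormedSpace ℝ V]
    [NormedAddCommGroup H] [InnerProductSpace ℝ H] (ι : V →L[ℝ] H) (h : H) (v : V) :
    toDualOf ι h v = inner ℝ (ι v) h := by
  simp [toDualOf, real_inner_comm]

/-- The incremental product rule for the pairing `(ι y, z)`. -/
theorem inner_sub_inner_eq_of_toDualOf {V H : Type*} [NormedAddCommGroup V] [NormedSpace ℝ V]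
    [NormedAddCommGroup H] [InnerProductSpace ℝ H] (ι : V →L[ℝ] H) (y₀ y₁ : V) (z₀ z₁ : H) :
    inner ℝ (ι y₁) z₁ - inner ℝ (ι y₀) z₀ =
      inner ℝ (ι y₁ - ι y₀) z₁ + (toDualOf ι z₁ - toDualOf ι z₀) y₀ := by
  rw [_root_.sub_apply, toDualOf_apply, toDualOf_apply, inner_sub_left]
  ring

theorem lemma4p5
    {V H : Type*}
    [NormedAddCommGroup V] [InnerProductSpace ℝ V] [CompleteSpace V]
    [NormedAddCommGroup H] [InnerProductSpace ℝ H] [CompleteSpace H]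
    (ι : V →L[ℝ] H) (T : ℝ) (hT : 0 < T)
    (y : ℝ → V) (z : ℝ → H)
    (hyH : MemH1 T (fun t => ι (y t))) (hyV : MemL2 T y)
    (hzV : MemH1 T (fun t => toDualOf ι (z t))) (hzH : MemL2 T z)
    (y' : ℝ → H) (hy' : IsWeakDeriv T (fun t => ι (y t)) y')
    (z' : ℝ → StrongDual ℝ V) (hz' : IsWeakDeriv T (fun t => toDualOf ι (z t)) z') :
    ∃ g : ℝ → ℝ,
      AbsolutelyContinuousOnInterval g 0 T ∧
      (∀ᵐ t ∂(volume.restrict (Ioo 0 T)), g t = inner ℝ (ι (y t)) (z t)) ∧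
      (∃ (yc : ℝ → H) (zc : ℝ → StrongDual ℝ V),
        IsContRepr T (fun t => ι (y t)) yc ∧ IsContRepr T (fun t => toDualOf ι (z t)) zc ∧
        ∀ t ∈ Icc (0 : ℝ) T,
          (∀ h : H, zc t = toDualOf ι h → g t = inner ℝ (yc t) h) ∧
          (∀ v : V, yc t = ι v → g t = zc t v)) ∧
      (∀ᵐ t ∂(volume.restrict (Ioo 0 T)),
        HasDerivAt g (inner ℝ (y' t) (z t) + z' t (y t)) t) := by
  obtain ⟨yc, P, hyc, mP, hP, hPy, incy⟩ := hyH.exists_contRepr hT hy'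
  obtain ⟨zc, Q, hzc, mQ, hQ, hQz, incz⟩ := hzV.exists_contRepr hT hz'
  obtain ⟨Y, mY, hY, hYy⟩ := hyV.exists_stronglyMeasurable_memLp
  obtain ⟨Z, mZ, hZ, hZz⟩ := hzH.exists_stronglyMeasurable_memLp
  have hycY : ∀ᵐ t, t ∈ Ioo 0 T → yc t = ι (Y t) := by
    filter_upwards [(ae_restrict_iff' measurableSet_Ioo).1 hyc.2, hYy] with t h1 h2 ht
    rw [h1 ht, h2 ht]
  have hzcZ : ∀ᵐ t, t ∈ Ioo 0 T → zc t = toDualOf ι (Z t) := by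
    filter_upwards [(ae_restrict_iff' measurableSet_Ioo).1 hzc.2, hZz] with t h1 h2 ht
    rw [h1 ht, h2 ht]
  let B₁ : H →L[ℝ] H →L[ℝ] ℝ := innerSL ℝ
  let B₂ : StrongDual ℝ V →L[ℝ] V →L[ℝ] ℝ := ContinuousLinearMap.id ℝ _
  let B₃ : V →L[ℝ] H →L[ℝ] ℝ := B₁.comp ι
  let f : ℝ → ℝ := fun t => inner ℝ (ι (Y t)) (Z t)
  have hf : Integrable f := hY.integrable_bilin B₃ hZ
  let G : ℝ → ℝ := fun t => inner ℝ (P t) (Z t) + Q t (Y t)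
  have hG : Integrable G := (hP.integrable_bilin B₁ hZ).add (hQ.integrable_bilin B₂ hY)
  have hGi : ∀ a b, IntervalIntegrable G volume a b := fun a b => hG.intervalIntegrable
  obtain ⟨S, hS, hSinc⟩ := exists_ae_sub_eq_integral_of_difference B₁ B₂ (T := T) hf mP mZ mQ
    hP hZ hQ hY (fun η hη => by
      have hgood := hycY.and hzcZ
      -- Translation preserves null sets, so the identities also hold at t + η for a.e. t.
      have hgood' : ∀ᵐ t : ℝ, (t + η ∈ Ioo 0 T → yc (t + η) = ι (Y (t + η))) ∧
          (t + η ∈ Ioo 0 T → zc (t + η) = toDualOf ι (Z (t + η))) :=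
        (measurePreserving_add_right volume η).quasiMeasurePreserving.ae hgood
      filter_upwards [hgood, hgood'] with t h0 h1 ht
      have t0 : t ∈ Ioo 0 T := ⟨ht.1, by linarith [ht.2]⟩
      have t1 : t + η ∈ Ioo 0 T := ⟨by linarith [ht.1], by linarith [ht.2]⟩
      rw [← incy t (Ioo_subset_Icc_self t0) _ (Ioo_subset_Icc_self t1),
        ← incz t (Ioo_subset_Icc_self t0) _ (Ioo_subset_Icc_self t1),
        h0.1 t0, h0.2 t0, h1.1 t1, h1.2 t1]
      exact inner_sub_inner_eq_of_toDualOf ι _ _ _ _)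
  obtain ⟨a, haS, ha⟩ : ∃ a ∈ S, a ∈ Ioo 0 T := by
    have hpos : (volume.restrict (Ioo 0 T)) ≠ 0 := by
      rw [Ne, Measure.restrict_eq_zero, Real.volume_Ioo]
      simpa using hT
    have : (ae (volume.restrict (Ioo 0 T))).NeBot := ae_neBot.2 hpos
    have hmem : ∀ᵐ t ∂(volume.restrict (Ioo 0 T)), t ∈ S ∧ t ∈ Ioo 0 T :=
      (ae_restrict_of_ae hS).and (ae_restrict_mem measurableSet_Ioo)
    obtain ⟨a, h1, h2⟩ := hmem.exists
    exact ⟨a, h1, h2⟩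
  let g : ℝ → ℝ := fun t => f a + ∫ r in a..t, G r
  have hgf : ∀ t ∈ S, t ∈ Ioo 0 T → g t = f t := by
    intro t htS ht
    rcases le_total a t with hat | hat
    · linarith [hSinc a haS t htS ha.1 hat ht.2, show g t = f a + ∫ r in a..t, G r from rfl,
        show ∫ r in a..t, G r = ∫ r in a..t, (B₁ (P r) (Z r) + B₂ (Q r) (Y r)) from rfl]
    · linarith [hSinc t htS a haS ht.1 hat ha.2, show g t = f a + ∫ r in a..t, G r from rfl,
        show ∫ r in t..a, G r = ∫ r in t..a, (B₁ (P r) (Z r) + B₂ (Q r) (Y r)) from rfl,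
        intervalIntegral.integral_symm (μ := volume) (f := G) t a]
  have hga : AbsolutelyContinuousOnInterval g 0 T :=
    (absolutelyContinuousOnInterval_const (f a) 0 T).add
      ((hGi 0 T).absolutelyContinuousOnInterval_intervalIntegral
        (by rw [uIcc_of_le hT.le]; exact Ioo_subset_Icc_self ha))
  have hgc : ContinuousOn g (Icc 0 T) := by
    rw [← uIcc_of_le hT.le]; exact hga.continuousOn
  refine ⟨g, hga, ?_, ⟨yc, zc, hyc, hzc, fun t ht => ⟨fun h hh => ?_, fun v hv => ?_⟩⟩, ?_⟩
  · rw [ae_restrict_iff' measurableSet_Ioo]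
    filter_upwards [hS, hYy, hZz] with t h1 h2 h3 ht
    rw [hgf t h1 ht, ← h2 ht, ← h3 ht]
  · obtain ⟨C, hCb⟩ := exists_norm_intervalIntegral_sq_le hQ
    refine eq_of_sq_sub_le_abs_sub_mul hT (k := fun s => inner ℝ (yc s) h)
      (q := fun s => ‖Y s‖ ^ 2) (C := C) hgc (hyc.1.inner continuousOn_const)
      (hY.integrable_norm_pow two_ne_zero) ht ?_
    filter_upwards [hS, hycY, hzcZ] with s h1 h2 h3 hs
    -- Since h represents `zc t`, the product (y(s),h)_H equals ⟨`zc t`, y(s)⟩_V, leaving an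
    -- increment of `zc`.
    have e : g s - inner ℝ (yc s) h = (zc s - zc t) (Y s) := by
      rw [hgf s h1 hs, h2 hs, h3 hs, hh, _root_.sub_apply, toDualOf_apply,
        toDualOf_apply]
    have hb := hCb t s
    rw [← incz t ht s (Ioo_subset_Icc_self hs)] at hb
    rw [e, ← sq_abs]
    calc |(zc s - zc t) (Y s)| ^ 2 ≤ (‖zc s - zc t‖ * ‖Y s‖) ^ 2 := by
          gcongr; exact (zc s - zc t).le_opNorm (Y s)
      _ = ‖zc s - zc t‖ ^ 2 * ‖Y s‖ ^ 2 := mul_pow _ _ _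
      _ ≤ C * |s - t| * ‖Y s‖ ^ 2 := by gcongr
  · obtain ⟨C, hCb⟩ := exists_norm_intervalIntegral_sq_le hP
    refine eq_of_sq_sub_le_abs_sub_mul hT (k := fun s => zc s v)
      (q := fun s => ‖Z s‖ ^ 2) (C := C) hgc (hzc.1.clm_apply continuousOn_const)
      (hZ.integrable_norm_pow two_ne_zero) ht ?_
    filter_upwards [hS, hycY, hzcZ] with s h1 h2 h3 hs
    -- Here the increment falls on `yc`, because ⟨`zc s`, v⟩_V = (`yc t`, z(s))_H.
    have e : g s - zc s v = inner ℝ (yc s - yc t) (Z s) := by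
      rw [hgf s h1 hs, h2 hs, h3 hs, hv, inner_sub_left, toDualOf_apply]
    have hb := hCb t s
    rw [← incy t ht s (Ioo_subset_Icc_self hs)] at hb
    rw [e, ← sq_abs]
    calc |inner ℝ (yc s - yc t) (Z s)| ^ 2 ≤ (‖yc s - yc t‖ * ‖Z s‖) ^ 2 := by
          gcongr; exact abs_real_inner_le_norm _ _
      _ = ‖yc s - yc t‖ ^ 2 * ‖Z s‖ ^ 2 := mul_pow _ _ _
      _ ≤ C * |s - t| * ‖Z s‖ ^ 2 := by gcongr
  · rw [ae_restrict_iff' measurableSet_Ioo]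
    filter_upwards [LocallyIntegrable.ae_hasDerivAt_integral hG.locallyIntegrable, hPy, hQz, hYy,
      hZz] with t h1 h2 h3 h4 h5 ht
    rw [← h2 ht, ← h3 ht, ← h4 ht, ← h5 ht]
    exact (h1 a).const_add (f a)
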